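/- Let $k\ge 0$ be an integer and let $K=(K_0,\dots,K_k)$ be a sequence of finite sets with the discrete topology. For a set $S$ let $\mathrm{Inj}([i],S)$ be the set of injections $[i]=\{1,\dots,i\}\to S$. For a sequence $Y=(Y_0,\dots,Y_k)$ of spaces put $Y^{(S)}:=\prod_{i\le k}Y_i^{\mathrm{Inj}([i],S)}$ (the $Y$-coloured directed hypergraphs on $S$), with coordinate projections $\pi_\phi$. A Borel probability measure $\mu$ on $K^{(S)}$ is called exchangeable if it is invariant under $(\omega_\phi)_\phi\mapsto(\omega_{g\circ\phi})_\phi$ for every finitely supported permutation $g$ of $S$. For maps $\Lambda_i:Y_i\to Z_i$ $(0\le i\le k)$ write $\Lambda^{(S)}:Y^{(S)}\to Z^{(S)}$ for the map $(y_\phi)_{\phi}\mapsto(\Lambda_i(y_\phi))_{i\le k,\ \phi\in\mathrm{Inj}([i],S)}$, and write $f_\#$ for push-forward of measures under $f$. Let $S_1,S_2$ be disjoint countably infinite sets. For $0\le i\le k$ put $$K_i^{\uplus S_2}:=\prod_{j=0}^{k-i}K_{i+j}^{\binom{[i+j]}{[i]}\times\mathrm{Inj}([j],S_2)},$$ where $\binom{[i+j]}{[i]}$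 is the set of $i$-element subsets of $[i+j]$, and identify $K^{(S_1\cup S_2)}$ with $(K^{\uplus S_2})^{(S_1)}$ as follows: a triple $(\phi,T,\chi)\in\mathrm{Inj}([i],S_1)\times\binom{[i+j]}{[i]}\times\mathrm{Inj}([j],S_2)$ corresponds to the injection $[i+j]\to S_1\cup S_2$ that lists $\phi$ in order along $T$ and $\chi$ in order along $[i+j]\setminus T$. For a probability measure $\mu'$ on $K^{(S_1\cup S_2)}$ let $(\mu')^{\uplus S_2}$ be its image on $(K^{\uplus S_2})^{(S_1)}$ under this identification. **Theorem.** Let $\mu$ be an exchangeable probability measure on $K^{(S_1)}$. Then there is a unique exchangeable probability measure $\mu'$ on $K^{(S_1\cup S_2)}$ whose image under restriction to $S_1$ is $\mu$. Moreover there are totally disconnected compact metric spaces $Z_0,\dots,Z_k$ and continuous maps $\kappa_i:Z_i\to K_i$ and $\Lambda_i:K_i^{\uplus S_2}\to Z_i$ $(0\le i\le k)$ such that, with $\nu:=\Lambda^{(S_1)}_\#(\mu')^{\uplus S_2}$, a Borel probability measure on $Z^{(S_1)}$: 1. for every $i\le k$, under $\nu$ the clusters of random variables $(\pi_\phi)_{\phi\in\mathrm{Inj}([i],S_1),\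 \phi([i])=u}$, one for each $i$-element subset $u$ of $S_1$, are conditionally independent given all the random variables $\pi_\psi$ with $\psi\in\mathrm{Inj}([j],S_1)$, $j<i$; 2. $\mu=\kappa^{(S_1)}_\#\nu=\kappa^{(S_1)}_\#\Lambda^{(S_1)}_\#(\mu')^{\uplus S_2}$. -/

import Mathlib

open MeasureTheory ProbabilityTheory

universe u v w

/-- The space `K^(S) = ∏_{i ≤ k} K_i ^ Inj([i], S)` of all `K`-coloured directed hypergraphs on the
vertex set `S`, where `K = (K_0, …, K_k)`: every injection `φ : [i] → S` with `i ≤ k` gets a colour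
in `K_i`. It carries the product topology and the product σ-algebra. -/
abbrev DirColouring {k : ℕ} (K : Fin (k + 1) → Type u) (S : Type v) : Type (max u v) :=
  (i : Fin (k + 1)) → (Fin i ↪ S) → K i

namespace DirColouring

variable {k : ℕ}

/-- Pulling a colouring back along an injection `f` of vertex sets: the colour of `φ` is the old
colour of `f ∘ φ`. For a permutation `g` of `S` this is the coordinate-permuting map `τ^g`; for the
inclusion of `S₁` into `S₁ ⊕ S₂` it is the restriction to `S₁` (the induced directed hypergraph). -/
def pull {K : Fin (k + 1) → Type u} {S : Type v} {T : Type w} (f : S ↪ T)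
    (ω : DirColouring K T) : DirColouring K S :=
  fun i φ => ω i (φ.trans f)

/-- An exchangeable random `K`-coloured directed hypergraph on `S`: a probability measure on
`K^(S)` that is invariant under `τ^g` for every finitely supported permutation `g` of `S`. -/
structure IsExchangeable {K : Fin (k + 1) → Type u} [∀ i, MeasurableSpace (K i)] {S : Type v}
    (μ : Measure (DirColouring K S)) : Prop where
  isProbabilityMeasure : IsProbabilityMeasure μ
  map_perm : ∀ g : Equiv.Perm S, {s | g s ≠ s}.Finite → μ.map (pull g.toEmbedding) = μ

/-- `μ'`, on the disjoint union `S₁ ⊕ S₂`, is an exchangeable extension of `μ`, on `S₁`. -/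
def IsExchangeableExtension {K : Fin (k + 1) → Type u} [∀ i, MeasurableSpace (K i)]
    {S₁ : Type v} {S₂ : Type w} (μ : Measure (DirColouring K S₁))
    (μ' : Measure (DirColouring K (S₁ ⊕ S₂))) : Prop :=
  IsExchangeable μ' ∧ μ'.map (pull Function.Embedding.inl) = μ

/-- The hypergraph power `Λ^(S) : Y^(S) → Z^(S)` of a sequence of maps `Λ_i : Y_i → Z_i`. -/
def power {Y : Fin (k + 1) → Type u} {Z : Fin (k + 1) → Type w} (Λ : ∀ i, Y i → Z i) (S : Type v)
    (y : DirColouring Y S) : DirColouring Z S :=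
  fun i φ => Λ i (y i φ)

/-- The `S₂`-internalization `K^{⊎S₂}` of a palette `K`, at rank `i`:
`∏_{j = 0}^{k - i} K_{i+j} ^ (([i+j] choose [i]) × Inj([j], S₂))`. -/
abbrev Internalization (K : Fin (k + 1) → Type u) (S₂ : Type w) (i : Fin (k + 1)) :
    Type (max u w) :=
  (j : Fin (k + 1 - i)) → {T : Finset (Fin (i + j)) // T.card = i} × (Fin j ↪ S₂) →
    K ⟨i + j, by omega⟩

/-- The injection `[i + j] → S₁ ⊕ S₂` which is `φ`, in increasing order, on the `i`-subset `T`, and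
`χ`, in increasing order, on the complement of `T`. This is the identification of
`Inj([i], S₁) × ([i+j] choose [i]) × Inj([j], S₂)` with the set of those injections
`[i + j] → S₁ ⊕ S₂` that take exactly `i` values in `S₁`. -/
def glue {S₁ : Type v} {S₂ : Type w} {i j : ℕ} (φ : Fin i ↪ S₁)
    (T : {T : Finset (Fin (i + j)) // T.card = i}) (χ : Fin j ↪ S₂) : Fin (i + j) ↪ S₁ ⊕ S₂ :=
  (finSumEquivOfFinset (m := i) (n := j) T.2
    (by rw [Finset.card_compl, T.2, Fintype.card_fin]; omega)).symm.toEmbedding.trans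
      (φ.sumMap χ)

/-- The canonical identification of `K^(S₁ ⊕ S₂)` with `(K^{⊎S₂})^(S₁)`. Pushing a measure on
`K^(S₁ ⊕ S₂)` forward under it gives the `S₂`-internalization of the measure. -/
def internalize {K : Fin (k + 1) → Type u} {S₁ : Type v} {S₂ : Type w}
    (ω : DirColouring K (S₁ ⊕ S₂)) : DirColouring (Internalization K S₂) S₁ :=
  fun i φ j p => ω ⟨i + j, by omega⟩ (glue φ p.1 p.2)

/-- The cluster `(π_φ)_{φ ∈ Inj([i], u)}` of colours of the injections `φ : [i] → S` whose image is
the `i`-set `u`. -/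
def cluster {Z : Fin (k + 1) → Type u} {S : Type v} (i : Fin (k + 1))
    (u : {u : Finset S // u.card = i}) (ω : DirColouring Z S) :
    {φ : Fin i ↪ S // Finset.univ.map φ = u.1} → Z i :=
  fun φ => ω i φ.1

/-- The σ-algebra on `Z^(S)` generated by all `π_ψ` with `ψ ∈ Inj([j], S)`, `j < i`. -/
abbrev lowerSigma (Z : Fin (k + 1) → Type u) [∀ i, MeasurableSpace (Z i)] (S : Type v)
    (i : Fin (k + 1)) : MeasurableSpace (DirColouring Z S) :=
  ⨆ (j : Fin (k + 1)) (_ : j < i) (ψ : Fin j ↪ S),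
    MeasurableSpace.comap (fun ω : DirColouring Z S => ω j ψ) inferInstance

theorem lowerSigma_le (Z : Fin (k + 1) → Type u) [∀ i, MeasurableSpace (Z i)] (S : Type v)
    (i : Fin (k + 1)) : lowerSigma Z S i ≤ MeasurableSpace.pi :=
  iSup_le fun j => iSup_le fun _ => iSup_le fun ψ =>
    Measurable.comap_le ((measurable_pi_apply ψ).comp (measurable_pi_apply j))

instance {S : Type v} [Countable S] {n : ℕ} : Countable (Fin n ↪ S) :=
  DFunLike.coe_injective.countable

/-- Under the law `ν` on `Z^(S)`, for every rank `i ≤ k` the clusters belonging to the distinct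
`i`-subsets of `S` are relatively independent when conditioned on all colours of rank less
than `i`. -/
def ClustersRelIndep {Z : Fin (k + 1) → Type u} [∀ i, MeasurableSpace (Z i)]
    [∀ i, StandardBorelSpace (Z i)] {S : Type v} [Countable S]
    (ν : Measure (DirColouring Z S)) [IsFiniteMeasure ν] : Prop :=
  ∀ i : Fin (k + 1),
    iCondIndepFun (lowerSigma Z S i) (lowerSigma_le Z S i) (cluster (Z := Z) (S := S) i) ν

end DirColouring

/-! The palette `Z` can be the internalization itself, with `Λ` the identity and `κ` keeping only
the coordinate without vertices in `S₂`. All the content is in uniqueness of the extension and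
conditional independence.

Exchangeability concerns finitely supported permutations, but these move any finite window anywhere,
so the law is invariant under `pull τ` for every self-embedding `τ` of the vertices, surjective or
not (`IsExchangeable.map_pull_self`). This gives the extension and its uniqueness at once.

For independence, fix an `i`-set `u ⊆ S₁` and an event `B` seen on `u ∪ t` with `t ⊆ S₂` finite.
Since `S₂` is infinite, some embedding `τ` fixes `u ∪ t` and sends all other vertices into `S₂`
(`exists_embedding_fixing`). It carries an edge not containing `u` to one meeting `S₁` in a proper
subset of `u`, whose colour is internalized at rank below `i`. Let `A` be generated by the colours
of edges not containing `u`. Then `τ` takes `A` to a smaller σ-algebra, while invariance shows that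
the conditional expectations of `B` on both have the same second moment; being nested, they agree
(`IsExchangeable.condExp_avoidSigma_ae_eq_comap`). The internalized data of rank below `i` lie in
between, so conditioning `B` on them or on `A` is the same. The events over every other `i`-set lie
in `A`, and conditional independence follows by induction on the number of events
(`iCondIndepSets_of_condExp_ae_eq`). -/

/-! ### Conditional expectation and conditional independence. -/

section CondExp

variable {Ω Ω' : Type*}

/-- Conditional expectation commutes with pulling back along a measurable map. -/
theorem condExp_map_comp_ae_eq {m : MeasurableSpace Ω'} {mΩ : MeasurableSpace Ω}
    {mΩ' : MeasurableSpace Ω'} {T : Ω → Ω'} (hT : Measurable T) {μ : Measure Ω}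
    [IsFiniteMeasure μ] (hm : m ≤ mΩ') {f : Ω' → ℝ}
    (hf : Integrable f (μ.map T)) :
    (μ.map T)[f | m] ∘ T =ᵐ[μ] μ[f ∘ T | m.comap T] := by
  have hmT : m.comap T ≤ mΩ := (MeasurableSpace.comap_mono hm).trans hT.comap_le
  have hint : Integrable ((μ.map T)[f | m] ∘ T) μ :=
    (integrable_condExp (m := m) (f := f)).comp_measurable hT
  refine ae_eq_condExp_of_forall_setIntegral_eq hmT (hf.comp_measurable hT)
    (fun s _ _ => hint.integrableOn) ?_ ?_
  · rintro _ ⟨t, ht, rfl⟩ _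
    have h := setIntegral_condExp hm hf ht
    rw [setIntegral_map (hm _ ht) integrable_condExp.aestronglyMeasurable hT.aemeasurable,
      setIntegral_map (hm _ ht) hf.aestronglyMeasurable hT.aemeasurable] at h
    exact h
  · exact (stronglyMeasurable_condExp.comp_measurable
      (comap_measurable T)).aestronglyMeasurable

/-- If conditioning a square-integrable function on a smaller σ-algebra does not lower the second
moment, then it does not change the conditional expectation. -/
theorem condExp_ae_eq_of_integral_sq_eq {m₁ m₂ mΩ : MeasurableSpace Ω} {μ : Measure Ω}
    [IsFiniteMeasure μ] (h₁₂ : m₁ ≤ m₂) (h₂ : m₂ ≤ mΩ) {f : Ω → ℝ} (hf : MemLp f 2 μ)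
    (hsq : ∫ ω, (μ[f | m₂]) ω ^ 2 ∂μ = ∫ ω, (μ[f | m₁]) ω ^ 2 ∂μ) :
    μ[f | m₂] =ᵐ[μ] μ[f | m₁] := by
  set g := μ[f | m₂] with hg
  set h := μ[f | m₁] with hh
  have hgL : MemLp g 2 μ := hf.condExp (by norm_num)
  have hhL : MemLp h 2 μ := hf.condExp (by norm_num)
  have hgh : Integrable (h * g) μ := hhL.integrable_mul hgL
  have htower : μ[g | m₁] =ᵐ[μ] h := condExp_condExp_of_le h₁₂ h₂
  -- `h` is the orthogonal projection of `g`, so `g - h` is orthogonal to `h`; Pythagoras then makes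
  -- its norm the difference of second moments.
  have hcross : ∫ ω, h ω * g ω ∂μ = ∫ ω, h ω ^ 2 ∂μ := by
    have hpull : μ[h * g | m₁] =ᵐ[μ] h * μ[g | m₁] :=
      condExp_mul_of_stronglyMeasurable_left stronglyMeasurable_condExp hgh
        (hgL.integrable one_le_two)
    calc ∫ ω, h ω * g ω ∂μ = ∫ ω, (μ[h * g | m₁]) ω ∂μ :=
          (integral_condExp (h₁₂.trans h₂)).symm
      _ = ∫ ω, h ω ^ 2 ∂μ := by
          refine integral_congr_ae ?_
          filter_upwards [hpull, htower] with ω h1 h2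
          rw [h1, Pi.mul_apply, h2, sq]
  have hzero : ∫ ω, (g ω - h ω) ^ 2 ∂μ = 0 := by
    have hexp : ∀ ω, (g ω - h ω) ^ 2 = g ω ^ 2 - 2 * (h ω * g ω) + h ω ^ 2 := fun ω => by ring
    have hgh2 : Integrable (fun ω => 2 * (h ω * g ω)) μ := hgh.const_mul 2
    have hdiff : Integrable (fun ω => g ω ^ 2 - 2 * (h ω * g ω)) μ := hgL.integrable_sq.sub hgh2
    simp_rw [hexp]
    rw [integral_add hdiff hhL.integrable_sq, integral_sub hgL.integrable_sq hgh2,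
      integral_const_mul, hcross, hsq]
    ring
  have hsub : Integrable (fun ω => (g ω - h ω) ^ 2) μ := (hgL.sub hhL).integrable_sq
  rw [integral_eq_zero_iff_of_nonneg (fun ω => sq_nonneg _) hsub] at hzero
  filter_upwards [hzero] with ω hω
  exact sub_eq_zero.1 (pow_eq_zero_iff two_ne_zero |>.1 hω)

/-- If two nested σ-algebras give the same conditional expectation, so does every σ-algebra in
between. -/
theorem condExp_ae_eq_of_between {m₁ m m₂ mΩ : MeasurableSpace Ω} {μ : Measure Ω}
    [IsFiniteMeasure μ] (h₁ : m₁ ≤ m) (h₂ : m ≤ m₂) (hm₂ : m₂ ≤ mΩ) {f : Ω → ℝ}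
    (h : μ[f | m₂] =ᵐ[μ] μ[f | m₁]) : μ[f | m₂] =ᵐ[μ] μ[f | m] := by
  have hm : m ≤ mΩ := h₂.trans hm₂
  have h3 : μ[μ[f | m₂] | m] =ᵐ[μ] μ[f | m] := condExp_condExp_of_le h₂ hm₂
  have h4 : μ[μ[f | m₂] | m] =ᵐ[μ] μ[μ[f | m₁] | m] := condExp_congr_ae h
  have h5 : μ[μ[f | m₁] | m] = μ[f | m₁] :=
    condExp_of_stronglyMeasurable hm (stronglyMeasurable_condExp.mono h₁) integrable_condExp
  rw [h5] at h4
  exact h.trans (h4.symm.trans h3)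

/-- A family of classes of events is conditionally independent given `m` as soon as, for each
index, conditioning the events of that index on a larger σ-algebra that contains `m` and the events
of all other indices has the same effect as conditioning on `m`. -/
theorem iCondIndepSets_of_condExp_ae_eq {ι : Type*} {m mΩ : MeasurableSpace Ω}
    [StandardBorelSpace Ω] {μ : Measure Ω} [IsFiniteMeasure μ] (hm : m ≤ mΩ) (π : ι → Set (Set Ω))
    (hπ : ∀ i, ∀ s ∈ π i, MeasurableSet s) (A : ι → MeasurableSpace Ω) (hA : ∀ i, A i ≤ mΩ)
    (hmA : ∀ i, m ≤ A i) (hπA : ∀ i j, i ≠ j → ∀ s ∈ π j, MeasurableSet[A i] s)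
    (h : ∀ i, ∀ s ∈ π i, μ⟦s | A i⟧ =ᵐ[μ] μ⟦s | m⟧) :
    iCondIndepSets m hm π μ := by
  classical
  rw [iCondIndepSets_iff m hm π hπ]
  intro s f hf
  induction s using Finset.induction_on with
  | empty =>
    have h1 : μ[(fun _ => 1 : Ω → ℝ) | m] = fun _ => 1 := condExp_const hm 1
    simp [h1, Pi.one_def]
  | insert i s hi ih =>
    have hfs : ∀ j ∈ s, f j ∈ π j := fun j hj => hf j (Finset.mem_insert_of_mem hj)
    have hfi : f i ∈ π i := hf i (Finset.mem_insert_self i s)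
    set R : Set Ω := ⋂ j ∈ s, f j with hR
    have hRA : MeasurableSet[A i] R :=
      MeasurableSet.biInter s.countable_toSet fun j hj =>
        hπA i j (fun hij => hi (hij ▸ hj)) _ (hfs j hj)
    set a : Ω → ℝ := (f i).indicator fun _ => 1
    set b : Ω → ℝ := R.indicator fun _ => 1 with hb
    have ha_int : Integrable a μ := (integrable_const 1).indicator (hπ i _ hfi)
    have hb_int : Integrable b μ := (integrable_const 1).indicator (hA i _ hRA)
    have hb_meas : StronglyMeasurable[A i] b := stronglyMeasurable_const.indicator hRA
    have hb_bound : ∀ ω, ‖b ω‖ ≤ 1 := fun ω => by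
      by_cases hω : ω ∈ R <;> simp [hb, hω]
    have hba : (⋂ j ∈ insert i s, f j).indicator (fun _ => (1 : ℝ)) = b * a := by
      rw [Finset.set_biInter_insert, Set.inter_comm, ← hR]
      funext ω
      by_cases h1 : ω ∈ R <;> by_cases h2 : ω ∈ f i <;> simp [a, b, h1, h2]
    have hprod {c : Ω → ℝ} (hc : Integrable c μ) : Integrable (b * c) μ :=
      hc.bdd_mul hb_int.aestronglyMeasurable (Filter.Eventually.of_forall hb_bound)
    -- Condition on `A i` first: it contains the events of all other indices, so `b` factors out,
    -- and `a` then sees only `m`.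
    have e1 : μ[b * a | A i] =ᵐ[μ] b * μ[a | A i] :=
      condExp_mul_of_stronglyMeasurable_left hb_meas (hprod ha_int) ha_int
    have e2 : b * μ[a | A i] =ᵐ[μ] b * μ[a | m] := by
      filter_upwards [h i _ hfi] with ω hω
      rw [Pi.mul_apply, Pi.mul_apply, hω]
    have e3 : μ[b * μ[a | m] | m] =ᵐ[μ] μ[b | m] * μ[a | m] :=
      condExp_mul_of_stronglyMeasurable_right stronglyMeasurable_condExp
        (hprod integrable_condExp) hb_int
    have e4 : μ[b * a | m] =ᵐ[μ] μ[b | m] * μ[a | m] :=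
      ((condExp_condExp_of_le (hmA i) (hA i)).symm.trans
        (condExp_congr_ae (e1.trans e2))).trans e3
    rw [hba, Finset.prod_insert hi]
    filter_upwards [e4, ih hfs] with ω h1 h2
    rw [h1, Pi.mul_apply, Pi.mul_apply, mul_comm, h2]

/-- Conditional independence of a family of random variables under an image measure can be checked
upstairs. -/
theorem iCondIndepFun_map_of_iCondIndep {m₀ mΩ : MeasurableSpace Ω}
    {m mΩ' : MeasurableSpace Ω'} [StandardBorelSpace Ω] [StandardBorelSpace Ω']
    {T : Ω → Ω'} (hT : Measurable T) {μ : Measure Ω} [IsFiniteMeasure μ]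
    [IsFiniteMeasure (μ.map T)] (hm : m ≤ mΩ')
    (hm₀ : m₀ ≤ mΩ) (hm₀_eq : m₀ = m.comap T)
    {ι : Type*} {β : ι → Type*} [∀ i, MeasurableSpace (β i)] {X : ∀ i, Ω' → β i}
    (hX : ∀ i, Measurable (X i)) {M : ι → MeasurableSpace Ω} (hM : ∀ i, M i ≤ mΩ)
    (hXM : ∀ i, Measurable[M i] (X i ∘ T)) (h : iCondIndep m₀ hm₀ M μ) :
    iCondIndepFun m hm X (μ.map T) := by
  subst hm₀_eq
  rw [iCondIndepFun_iff m hm _ X hX]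
  rw [iCondIndep_iff _ hm₀ M hM] at h
  intro s g hg
  have hgm : ∀ i ∈ s, MeasurableSet (g i) := fun i hi => (hX i).comap_le _ (hg i hi)
  have hkey : ∀ t : Set Ω', MeasurableSet t →
      (μ.map T)⟦t | m⟧ ∘ T =ᵐ[μ] μ⟦T ⁻¹' t | m.comap T⟧ := fun t ht =>
    condExp_map_comp_ae_eq hT hm ((integrable_const 1).indicator ht)
  have hup := h s (f := fun i => T ⁻¹' g i) (fun i hi => by
    obtain ⟨B, hB, hBg⟩ := hg i hi
    rw [← hBg]
    exact hXM i hB)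
  have hall : ∀ᵐ ω ∂μ, ∀ i ∈ s,
      ((μ.map T)⟦g i | m⟧) (T ω) = (μ⟦T ⁻¹' g i | m.comap T⟧) ω :=
    (ae_ball_iff s.countable_toSet).2 fun i hi => hkey _ (hgm i hi)
  rw [Filter.EventuallyEq, ae_map_iff hT.aemeasurable]
  · filter_upwards [hup, hall, hkey _ (Finset.measurableSet_biInter s hgm)] with ω h1 h2 h3
    rw [Function.comp_apply] at h3
    rw [h3, Set.preimage_iInter₂, h1, Finset.prod_apply, Finset.prod_apply]
    exact Finset.prod_congr rfl fun i hi => (h2 i hi).symm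
  · refine measurableSet_eq_fun (stronglyMeasurable_condExp.mono hm).measurable ?_
    exact (Finset.stronglyMeasurable_prod s fun i _ =>
      (stronglyMeasurable_condExp (f := (g i).indicator fun _ => (1 : ℝ))).mono hm).measurable

end CondExp

/-! ### Exchangeable laws and embeddings of the vertex set. -/

/-- Any two embeddings of a finite set differ by a finitely supported permutation. -/
theorem Function.Embedding.exists_perm_finite_support {α : Type*} {β : Type*} [Finite α]
    (f g : α ↪ β) :
    ∃ σ : Equiv.Perm β, {x | σ x ≠ x}.Finite ∧ f.trans σ.toEmbedding = g := by
  classical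
  have hfin : (Set.range f ∪ Set.range g).Finite := (Set.finite_range f).union (Set.finite_range g)
  set V := Set.range f ∪ Set.range g
  have := hfin.to_subtype
  let f' : α → V := fun a => ⟨f a, .inl ⟨a, rfl⟩⟩
  let g' : α → V := fun a => ⟨g a, .inr ⟨a, rfl⟩⟩
  obtain ⟨σ, hσ⟩ := Equiv.Perm.exists_extending_pair f' g'
    (fun a b h => f.injective (congrArg Subtype.val h))
    (fun a b h => g.injective (congrArg Subtype.val h))
  refine ⟨Equiv.Perm.ofSubtype σ, hfin.subset fun x hx => ?_, ?_⟩
  · by_contra hxV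
    exact hx (Equiv.Perm.ofSubtype_apply_of_not_mem σ hxV)
  · ext a
    have h1 : Equiv.Perm.ofSubtype σ (f a) = σ (f' a) :=
      Equiv.Perm.ofSubtype_apply_coe σ (f' a)
    have h2 : σ (f' a) = g' a := hσ a
    simp [h1, h2, g']

namespace DirColouring

variable {k : ℕ} {K : Fin (k + 1) → Type u} {S : Type v} {T : Type w}

theorem pull_comp_pull {R : Type*} (f : R ↪ S) (g : S ↪ T) :
    pull (K := K) f ∘ pull g = pull (f.trans g) :=
  rfl

variable [∀ i, MeasurableSpace (K i)]

theorem measurable_apply (i : Fin (k + 1)) (e : Fin i ↪ S) :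
    Measurable fun ω : DirColouring K S => ω i e :=
  (measurable_pi_apply e).comp (measurable_pi_apply i)

theorem measurable_of_apply {Ω : Type*} {mΩ : MeasurableSpace Ω} {f : Ω → DirColouring K S}
    (hf : ∀ i e, Measurable fun x => f x i e) : Measurable f :=
  measurable_pi_lambda _ fun i => measurable_pi_lambda _ fun e => hf i e

theorem measurable_pull (f : S ↪ T) : Measurable (pull (K := K) f) :=
  measurable_of_apply fun i e => measurable_apply i (e.trans f)

variable (K) in
/-- The σ-algebra on `K^(S)` generated by the colours of the edges with all vertices in `D`. -/
abbrev localSigma (D : Set S) : MeasurableSpace (DirColouring K S) :=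
  MeasurableSpace.comap (pull (Function.Embedding.subtype (· ∈ D))) inferInstance

variable (K) in
/-- The σ-algebra on `K^(S)` generated by the colours of the edges that do not contain `U`. -/
abbrev avoidSigma (U : Set S) : MeasurableSpace (DirColouring K S) :=
  ⨆ (i : Fin (k + 1)) (e : Fin i ↪ S) (_ : ¬ U ⊆ Set.range e),
    MeasurableSpace.comap (fun ω : DirColouring K S => ω i e) inferInstance

theorem localSigma_le (D : Set S) : localSigma K D ≤ MeasurableSpace.pi :=
  (measurable_pull _).comap_le

theorem avoidSigma_le (U : Set S) : avoidSigma K U ≤ MeasurableSpace.pi :=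
  iSup_le fun i => iSup_le fun e => iSup_le fun _ => (measurable_apply i e).comap_le

theorem measurable_localSigma_apply {D : Set S} {i : Fin (k + 1)} {e : Fin i ↪ S}
    (he : ∀ x, e x ∈ D) : Measurable[localSigma K D] fun ω : DirColouring K S => ω i e :=
  (measurable_apply i (e.codRestrict D he)).comp (comap_measurable _)

theorem measurable_avoidSigma_apply {U : Set S} {i : Fin (k + 1)} {e : Fin i ↪ S}
    (he : ¬ U ⊆ Set.range e) :
    Measurable[avoidSigma K U] fun ω : DirColouring K S => ω i e := by
  refine Measurable.mono (comap_measurable _) ?_ le_rfl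
  exact le_iSup_of_le i (le_iSup_of_le e (le_iSup_of_le he le_rfl))

theorem localSigma_le_of_forall {D : Set S} {m : MeasurableSpace (DirColouring K S)}
    (h : ∀ (i : Fin (k + 1)) (e : Fin i ↪ S), (∀ x, e x ∈ D) →
      Measurable[m] fun ω : DirColouring K S => ω i e) : localSigma K D ≤ m := by
  refine Measurable.comap_le ?_
  exact measurable_of_apply fun i e => h i _ fun x => (e x).2

theorem localSigma_mono {D E : Set S} (h : D ⊆ E) : localSigma K D ≤ localSigma K E :=
  localSigma_le_of_forall fun _ _ he => measurable_localSigma_apply fun x => h (he x)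

theorem localSigma_le_avoidSigma {D U : Set S} (h : ¬ U ⊆ D) :
    localSigma K D ≤ avoidSigma K U :=
  localSigma_le_of_forall fun _ _ he => measurable_avoidSigma_apply fun hU =>
    h (hU.trans (Set.range_subset_iff.2 he))

theorem iSup_localSigma_finset :
    ⨆ F : Finset S, localSigma K (F : Set S) = MeasurableSpace.pi := by
  refine le_antisymm (iSup_le fun F => localSigma_le _) ?_
  have : @Measurable _ _ (⨆ F : Finset S, localSigma K (F : Set S)) MeasurableSpace.pi
      (id : DirColouring K S → DirColouring K S) := by
    refine measurable_of_apply fun i e => ?_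
    refine Measurable.mono (measurable_localSigma_apply (D := (Finset.univ.map e : Finset S))
      fun x => by simp) ?_ le_rfl
    exact le_iSup (fun F : Finset S => localSigma K (F : Set S)) _
  simpa using this.comap_le

/-- Under an exchangeable law, the sub-hypergraphs seen along any two embeddings have the same
law. -/
theorem IsExchangeable.map_pull_eq {μ : Measure (DirColouring K T)} (hμ : IsExchangeable μ)
    (f g : S ↪ T) : μ.map (pull f) = μ.map (pull g) := by
  classical
  have := hμ.isProbabilityMeasure
  have hf := Measure.isProbabilityMeasure_map (μ := μ) (measurable_pull (K := K) f).aemeasurable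
  have hg := Measure.isProbabilityMeasure_map (μ := μ) (measurable_pull (K := K) g).aemeasurable
  -- Events seen in finite windows form a generating π-system, so only the restrictions of `f` and
  -- `g` to a finite set `F` need comparing.
  refine ext_of_generate_finite
    (⋃ F : Finset S, {B | MeasurableSet[localSigma K (F : Set S)] B}) ?_ ?_ ?_ (by simp)
  · exact iSup_localSigma_finset.symm.trans
      (MeasurableSpace.generateFrom_iUnion_measurableSet _).symm
  · exact isPiSystem_iUnion_of_monotone _
      (fun F => @MeasurableSpace.isPiSystem_measurableSet _ (localSigma K (F : Set S)))
      fun F F' h B hB => localSigma_mono (K := K) (Finset.coe_subset.2 h) B hB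
  · rintro _ hA
    obtain ⟨F, B, hB, rfl⟩ := Set.mem_iUnion.1 hA
    clear hA
    set r := Function.Embedding.subtype (· ∈ (F : Set S))
    obtain ⟨σ, hσ, hσr⟩ := (r.trans f).exists_perm_finite_support (r.trans g)
    have key : (μ.map (pull f)).map (pull r) = (μ.map (pull g)).map (pull r) := by
      calc (μ.map (pull f)).map (pull r) = μ.map (pull (r.trans f)) :=
            Measure.map_map (measurable_pull _) (measurable_pull _)
        _ = (μ.map (pull σ.toEmbedding)).map (pull (r.trans f)) := by rw [hμ.map_perm σ hσ]
        _ = μ.map (pull ((r.trans f).trans σ.toEmbedding)) :=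
            Measure.map_map (measurable_pull _) (measurable_pull _)
        _ = μ.map (pull (r.trans g)) := by rw [hσr]
        _ = (μ.map (pull g)).map (pull r) :=
            (Measure.map_map (measurable_pull r) (measurable_pull g)).symm
    rw [← Measure.map_apply (measurable_pull r) hB, key,
      Measure.map_apply (measurable_pull r) hB]

theorem IsExchangeable.map_pull {μ : Measure (DirColouring K T)} (hμ : IsExchangeable μ)
    (f : S ↪ T) : IsExchangeable (μ.map (pull f)) := by
  have := hμ.isProbabilityMeasure
  refine ⟨Measure.isProbabilityMeasure_map (measurable_pull f).aemeasurable, fun g _ => ?_⟩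
  rw [Measure.map_map (measurable_pull _) (measurable_pull _), pull_comp_pull]
  exact hμ.map_pull_eq _ _

/-- Compare `f` with the identity embedding. The gain over exchangeability is that `f` may move
infinitely many vertices and miss others. -/
theorem IsExchangeable.map_pull_self {μ : Measure (DirColouring K S)} (hμ : IsExchangeable μ)
    (f : S ↪ S) : μ.map (pull f) = μ := by
  rw [hμ.map_pull_eq f (Function.Embedding.refl S)]
  exact Measure.map_id

/-- An exchangeable law on an infinite countable vertex set extends uniquely to a larger countable
vertex set. -/
theorem IsExchangeable.existsUnique_extension {S₁ : Type v} {S₂ : Type w} [Countable S₁]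
    [Infinite S₁] [Countable S₂] {μ : Measure (DirColouring K S₁)} (hμ : IsExchangeable μ) :
    ∃! μ' : Measure (DirColouring K (S₁ ⊕ S₂)), IsExchangeableExtension μ μ' := by
  obtain ⟨e⟩ : Nonempty (S₁ ⊕ S₂ ≃ S₁) := nonempty_equiv_of_countable
  refine ⟨μ.map (pull e.toEmbedding), ⟨hμ.map_pull _, ?_⟩, ?_⟩
  · rw [Measure.map_map (measurable_pull _) (measurable_pull _), pull_comp_pull]
    exact hμ.map_pull_self _
  · rintro μ' ⟨hμ', rfl⟩
    -- Restricting to `S₁` and transporting back along `e` is pulling back along a self-embedding of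
    -- `S₁ ⊕ S₂`, which preserves `μ'`.
    rw [Measure.map_map (measurable_pull _) (measurable_pull _), pull_comp_pull]
    exact (hμ'.map_pull_self _).symm

/-- Let `τ` be an embedding of the vertex set into itself that fixes `D`. Under an exchangeable
law, an event seen inside `D` has the same conditional probability given the colours of all edges
not containing `U` and given the colours of the images of these edges under `τ`. -/
theorem IsExchangeable.condExp_avoidSigma_ae_eq_comap {μ : Measure (DirColouring K S)}
    (hμ : IsExchangeable μ) {U D : Set S} (τ : S ↪ S) (hτ : ∀ x ∈ D, τ x = x)
    (hτU : (avoidSigma K U).comap (pull τ) ≤ avoidSigma K U)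
    {B : Set (DirColouring K S)} (hB : MeasurableSet[localSigma K D] B) :
    μ⟦B | avoidSigma K U⟧ =ᵐ[μ] μ⟦B | (avoidSigma K U).comap (pull τ)⟧ := by
  have := hμ.isProbabilityMeasure
  have hτB : pull τ ⁻¹' B = B := by
    obtain ⟨C, -, rfl⟩ := hB
    rw [← Set.preimage_comp, pull_comp_pull]
    congr 2
    ext x
    exact hτ x x.2
  set f : DirColouring K S → ℝ := B.indicator fun _ => 1 with hf
  have hfL : MemLp f 2 μ :=
    memLp_indicator_const 2 (localSigma_le D B hB) (1 : ℝ) (.inr (measure_ne_top _ _))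
  have hfτ : f ∘ pull τ = f := by
    funext ω
    have hω : pull τ ω ∈ B ↔ ω ∈ B := Set.ext_iff.1 hτB ω
    by_cases h : ω ∈ B <;> simp [hf, h, hω]
  have hmap := hμ.map_pull_self τ
  have hcomp : μ[f | avoidSigma K U] ∘ pull τ =ᵐ[μ] μ[f | (avoidSigma K U).comap (pull τ)] := by
    have h := condExp_map_comp_ae_eq (measurable_pull (K := K) τ) (μ := μ) (avoidSigma_le U)
      (f := f) (by rw [hmap]; exact hfL.integrable one_le_two)
    rwa [hmap, hfτ] at h
  -- By `hcomp` one conditional expectation is the other composed with the measure-preserving map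
  -- `pull τ`, so the second moments agree.
  refine condExp_ae_eq_of_integral_sq_eq hτU (avoidSigma_le U) hfL ?_
  have hmeas : StronglyMeasurable (μ[f | avoidSigma K U]) :=
    stronglyMeasurable_condExp.mono (avoidSigma_le U)
  calc ∫ ω, (μ[f | avoidSigma K U]) ω ^ 2 ∂μ
      = ∫ ω, (μ[f | avoidSigma K U]) ω ^ 2 ∂(μ.map (pull τ)) := by rw [hmap]
    _ = ∫ ω, (μ[f | avoidSigma K U]) (pull τ ω) ^ 2 ∂μ :=
        integral_map (measurable_pull τ).aemeasurable (hmeas.pow 2).aestronglyMeasurable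
    _ = _ := by
        refine integral_congr_ae ?_
        filter_upwards [hcomp] with ω hω
        rw [← hω, Function.comp_apply]

/-- Let `τ` be an embedding of the vertex set into itself that fixes `D`. Under an exchangeable
law, conditioning an event seen inside `D` on the colours of all edges not containing `U`, or on
fewer data which still include the colours of the images of these edges under `τ`, amounts to the
same. -/
theorem IsExchangeable.condExp_avoidSigma_ae_eq {μ : Measure (DirColouring K S)}
    (hμ : IsExchangeable μ) {U D : Set S} (τ : S ↪ S) (hτ : ∀ x ∈ D, τ x = x)
    {G : MeasurableSpace (DirColouring K S)}
    (hτG : (avoidSigma K U).comap (pull τ) ≤ G) (hG : G ≤ avoidSigma K U)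
    {B : Set (DirColouring K S)} (hB : MeasurableSet[localSigma K D] B) :
    μ⟦B | avoidSigma K U⟧ =ᵐ[μ] μ⟦B | G⟧ := by
  have := hμ.isProbabilityMeasure
  exact condExp_ae_eq_of_between hτG hG (avoidSigma_le U)
    (hμ.condExp_avoidSigma_ae_eq_comap τ hτ (hτG.trans hG) hB)

end DirColouring

/-! ### Gluing, internalization, and the embedding that empties `S₁` outside `u`. -/

namespace DirColouring

variable {k : ℕ} {K : Fin (k + 1) → Type u} {S₁ : Type v} {S₂ : Type w}

theorem glue_finSumEquivOfFinset {i j : ℕ} (φ : Fin i ↪ S₁)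
    (T : {T : Finset (Fin (i + j)) // T.card = i}) (χ : Fin j ↪ S₂) (hT : T.1ᶜ.card = j)
    (y : Fin i ⊕ Fin j) :
    glue φ T χ (finSumEquivOfFinset T.2 hT y) = Sum.map φ χ y := by
  simp [glue]

theorem mem_range_glue {i j : ℕ} {φ : Fin i ↪ S₁}
    {T : {T : Finset (Fin (i + j)) // T.card = i}} {χ : Fin j ↪ S₂} {x : S₁ ⊕ S₂} :
    x ∈ Set.range (glue φ T χ) ↔ x ∈ Set.range (Sum.map φ χ) := by
  have h := (finSumEquivOfFinset T.2
    (by rw [Finset.card_compl, T.2, Fintype.card_fin]; omega)).symm.surjective.range_comp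
      (Sum.map φ χ)
  rw [← h]
  rfl

@[simp]
theorem exists_glue_eq_inl {i j : ℕ} {φ : Fin i ↪ S₁}
    {T : {T : Finset (Fin (i + j)) // T.card = i}} {χ : Fin j ↪ S₂} {s : S₁} :
    (∃ x, glue φ T χ x = Sum.inl s) ↔ ∃ x, φ x = s := by
  rw [← Set.mem_range, mem_range_glue]
  simp

@[simp]
theorem exists_glue_eq_inr {i j : ℕ} {φ : Fin i ↪ S₁}
    {T : {T : Finset (Fin (i + j)) // T.card = i}} {χ : Fin j ↪ S₂} {s : S₂} :
    (∃ x, glue φ T χ x = Sum.inr s) ↔ ∃ x, χ x = s := by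
  rw [← Set.mem_range, mem_range_glue]
  simp

/-- Every injection into `S₁ ⊕ S₂` is obtained by gluing. -/
theorem exists_glue_eq {n : ℕ} (e : Fin n ↪ S₁ ⊕ S₂) :
    ∃ (i j : ℕ) (h : i + j = n) (φ : Fin i ↪ S₁) (T : {T : Finset (Fin (i + j)) // T.card = i})
      (χ : Fin j ↪ S₂), glue φ T χ = (finCongr h).toEmbedding.trans e := by
  classical
  -- `T` has to be the set of positions with value in `S₁`; `φ` and `χ` are then read off along `T`
  -- and its complement.
  obtain ⟨i, hi⟩ : ∃ i, (Finset.univ.filter fun x => (e x).isLeft).card = i := ⟨_, rfl⟩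
  obtain ⟨j, rfl⟩ : ∃ j, n = i + j :=
    Nat.exists_eq_add_of_le (hi ▸ (Finset.card_le_univ _).trans_eq (Fintype.card_fin n))
  set T := Finset.univ.filter fun x => (e x).isLeft
  have hTc : Tᶜ.card = j := by rw [Finset.card_compl, hi, Fintype.card_fin]; omega
  set E := finSumEquivOfFinset hi hTc
  have hl : ∀ x, ∃ s, e (E (.inl x)) = .inl s := fun x =>
    Sum.isLeft_iff.1 (Finset.mem_filter.1 (T.orderEmbOfFin_mem hi x)).2
  have hr : ∀ x, ∃ s, e (E (.inr x)) = .inr s := fun x =>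
    Sum.isRight_iff.1 (by
      have hx := Finset.mem_compl.1 (Tᶜ.orderEmbOfFin_mem hTc x)
      exact Sum.not_isLeft.1 fun h => hx (Finset.mem_filter.2 ⟨Finset.mem_univ _, h⟩))
  choose f hf using hl
  choose g hg using hr
  refine ⟨i, j, rfl, ⟨f, fun x y h => ?_⟩, ⟨T, hi⟩, ⟨g, fun x y h => ?_⟩, ?_⟩
  · exact Sum.inl_injective (E.injective (e.injective ((hf x).trans (h ▸ (hf y).symm))))
  · exact Sum.inr_injective (E.injective (e.injective ((hg x).trans (h ▸ (hg y).symm))))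
  · ext x : 1
    obtain ⟨y, rfl⟩ := E.surjective x
    refine (glue_finSumEquivOfFinset _ ⟨T, hi⟩ _ hTc y).trans ?_
    rcases y with y | y
    · exact (hf y).symm
    · exact (hg y).symm

theorem glue_univ {i : ℕ} (φ : Fin i ↪ S₁) (hT : (Finset.univ : Finset (Fin (i + 0))).card = i)
    (χ : Fin 0 ↪ S₂) : glue φ ⟨Finset.univ, hT⟩ χ = φ.trans Function.Embedding.inl := by
  ext x : 1
  have hTc : (Finset.univ : Finset (Fin (i + 0)))ᶜ.card = 0 := by simp
  have hx : finSumEquivOfFinset hT hTc (Sum.inl x) = x := by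
    rw [finSumEquivOfFinset_inl]
    exact (DFunLike.congr_fun (Finset.orderEmbOfFin_unique' hT (f := RelEmbedding.refl _)
      fun _ => Finset.mem_univ _) x).symm
  have h := glue_finSumEquivOfFinset φ ⟨Finset.univ, hT⟩ χ hTc (Sum.inl x)
  rw [hx] at h
  exact h

/-- The colour of an edge of `S₁`, read off from the internalized colour. -/
def externalColour (i : Fin (k + 1)) (z : Internalization K S₂ i) : K i :=
  z ⟨0, by omega⟩ (⟨Finset.univ, by simp⟩, Function.Embedding.ofIsEmpty)

theorem power_externalColour_internalize (ω : DirColouring K (S₁ ⊕ S₂)) :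
    power externalColour S₁ (internalize ω) = pull Function.Embedding.inl ω := by
  funext i φ
  exact congrArg (ω i) (glue_univ φ (by simp) _)

/-- There is room: `S₂` minus the finite set `t` is infinite, so it can absorb the countably many
vertices outside `u ∪ t`. -/
theorem exists_embedding_fixing [Countable S₁] [Countable S₂] [Infinite S₂] (u : Finset S₁)
    (t : Finset S₂) :
    ∃ τ : S₁ ⊕ S₂ ↪ S₁ ⊕ S₂, (∀ x ∈ Sum.inl '' (u : Set S₁) ∪ Sum.inr '' (t : Set S₂), τ x = x) ∧
      ∀ x s, τ x = Sum.inl s → s ∈ u ∧ x = Sum.inl s := by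
  classical
  set D : Set (S₁ ⊕ S₂) := Sum.inl '' (u : Set S₁) ∪ Sum.inr '' (t : Set S₂) with hD
  have : Infinite {s // s ∉ t} := t.finite_toSet.infinite_compl.to_subtype
  obtain ⟨c, hc⟩ := exists_injective_nat (S₁ ⊕ S₂)
  let g : S₁ ⊕ S₂ → {s // s ∉ t} := fun x => Infinite.natEmbedding _ (c x)
  have hg : Function.Injective g := (Infinite.natEmbedding _).injective.comp hc
  have hgD : ∀ x, Sum.inr (g x).1 ∉ D := fun x => by simpa [hD] using (g x).2
  refine ⟨⟨fun x => if x ∈ D then x else Sum.inr (g x).1, fun x y h => ?_⟩, fun x hx => ?_,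
    fun x s h => ?_⟩
  · by_cases hx : x ∈ D <;> by_cases hy : y ∈ D <;> simp only [hx, hy, if_true, if_false] at h
    · exact h
    · exact (hgD y (h ▸ hx)).elim
    · exact (hgD x (h ▸ hy)).elim
    · exact hg (Subtype.ext (Sum.inr_injective h))
  · exact if_pos hx
  · by_cases hx : x ∈ D
    · have h' : x = Sum.inl s := (if_pos hx).symm.trans h
      exact ⟨by simpa [hD, h'] using hx, h'⟩
    · exact absurd ((if_neg hx).symm.trans h) Sum.inr_ne_inl

/-! ### The σ-algebras of internalized colours. -/

variable [∀ i, MeasurableSpace (K i)]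

theorem measurable_internalization_of_apply {Ω : Type*} {mΩ : MeasurableSpace Ω}
    {i : Fin (k + 1)} {f : Ω → Internalization K S₂ i} (hf : ∀ j p, Measurable fun x => f x j p) :
    Measurable f :=
  measurable_pi_lambda _ fun j => measurable_pi_lambda _ fun p => hf j p

theorem measurable_internalize : Measurable (internalize (K := K) (S₁ := S₁) (S₂ := S₂)) :=
  measurable_of_apply fun _ _ => measurable_internalization_of_apply fun _ _ =>
    measurable_apply _ _

variable (K S₁ S₂) in
/-- The σ-algebra on `K^(S₁ ⊕ S₂)` generated by the internalized colours of rank below `i`. -/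
abbrev internalLowerSigma (i : Fin (k + 1)) : MeasurableSpace (DirColouring K (S₁ ⊕ S₂)) :=
  (lowerSigma (Internalization K S₂) S₁ i).comap internalize

theorem internalLowerSigma_le (i : Fin (k + 1)) :
    internalLowerSigma K S₁ S₂ i ≤ MeasurableSpace.pi :=
  (MeasurableSpace.comap_mono (lowerSigma_le _ _ i)).trans measurable_internalize.comap_le

/-- The `S₁`-vertices of `e` form a proper subset of `u`. Unglued, `e` is a coordinate of an
internalized colour at rank `j < i`. -/
theorem measurable_internalLowerSigma_apply {i : Fin (k + 1)} {u : Finset S₁} (hu : u.card = i)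
    {n : Fin (k + 1)} {e : Fin n ↪ S₁ ⊕ S₂} (h₁ : ∀ s, Sum.inl s ∈ Set.range e → s ∈ u)
    (h₂ : ¬ Sum.inl '' (u : Set S₁) ⊆ Set.range e) :
    Measurable[internalLowerSigma K S₁ S₂ i] fun ω : DirColouring K (S₁ ⊕ S₂) => ω n e := by
  obtain ⟨n, hn⟩ := n
  obtain ⟨j, l, h, φ, T, χ, hglue⟩ := exists_glue_eq e
  dsimp only at h
  subst h
  obtain rfl : glue φ T χ = e := hglue
  have hsub : Finset.univ.map φ ⊂ u := by
    refine Finset.ssubset_iff_subset_ne.2 ⟨fun s hs => h₁ s ?_, ?_⟩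
    · simpa using hs
    · rintro rfl
      refine h₂ ?_
      rintro _ ⟨s, hs, rfl⟩
      simpa using hs
  have hj : j < i := by
    have := Finset.card_lt_card hsub
    rwa [Finset.card_map, Finset.card_univ, Fintype.card_fin, hu] at this
  have hφ : Measurable[lowerSigma (Internalization K S₂) S₁ i]
      fun ω : DirColouring (Internalization K S₂) S₁ => ω ⟨j, by omega⟩ φ := by
    refine Measurable.mono (comap_measurable _) ?_ le_rfl
    exact le_iSup_of_le ⟨j, by omega⟩ (le_iSup_of_le (Fin.lt_def.2 hj) (le_iSup_of_le φ le_rfl))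
  have hcoord : Measurable fun z : Internalization K S₂ ⟨j, by omega⟩ =>
      z ⟨l, by simp only; omega⟩ (T, χ) :=
    (measurable_pi_apply (T, χ)).comp (measurable_pi_apply _)
  exact (hcoord.comp hφ).comp (comap_measurable internalize)

/-- An edge internalized at rank below `i` has fewer than `i` vertices in `S₁`, too few to contain
`u`. -/
theorem internalLowerSigma_le_avoidSigma {i : Fin (k + 1)} {u : Finset S₁} (hu : u.card = i) :
    internalLowerSigma K S₁ S₂ i ≤ avoidSigma K (Sum.inl '' (u : Set S₁)) := by
  simp only [internalLowerSigma, lowerSigma, MeasurableSpace.comap_iSup,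
    MeasurableSpace.comap_comp]
  refine iSup_le fun j => iSup_le fun hj => iSup_le fun ψ => Measurable.comap_le ?_
  refine measurable_internalization_of_apply fun l p => ?_
  refine measurable_avoidSigma_apply (i := ⟨j + l, by omega⟩) (e := glue ψ p.1 p.2) fun h => ?_
  have hsub : u ⊆ Finset.univ.map ψ := fun s hs => by
    simpa using h (Set.mem_image_of_mem _ hs)
  have := Finset.card_le_card hsub
  rw [hu, Finset.card_map, Finset.card_univ, Fintype.card_fin] at this
  exact absurd (Fin.lt_def.1 hj) (not_lt.2 this)

/-- After `τ`, an edge has no `S₁`-vertex outside `u`, and it covers `u` only if it did so before,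
since points of `u` have no preimage but themselves. -/
theorem comap_avoidSigma_le_internalLowerSigma {i : Fin (k + 1)} {u : Finset S₁}
    (hu : u.card = i) {τ : S₁ ⊕ S₂ ↪ S₁ ⊕ S₂}
    (hτ : ∀ x s, τ x = Sum.inl s → s ∈ u ∧ x = Sum.inl s) :
    (avoidSigma K (Sum.inl '' (u : Set S₁))).comap (pull τ) ≤ internalLowerSigma K S₁ S₂ i := by
  -- Hides the right-hand side, so that only the left is unfolded.
  generalize hG : internalLowerSigma K S₁ S₂ i = G
  simp only [avoidSigma, MeasurableSpace.comap_iSup, MeasurableSpace.comap_comp]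
  subst hG
  refine iSup_le fun n => iSup_le fun e => iSup_le fun he => Measurable.comap_le ?_
  refine measurable_internalLowerSigma_apply (K := K) (n := n) (e := e.trans τ) hu ?_ fun h => he ?_
  · rintro s ⟨x, hx⟩
    exact (hτ _ s hx).1
  · rintro _ ⟨s, hs, rfl⟩
    obtain ⟨x, hx⟩ := h (Set.mem_image_of_mem _ hs)
    exact ⟨x, (hτ _ s hx).2⟩

variable (K S₂) in
/-- The σ-algebra on `K^(S₁ ⊕ S₂)` generated by the colours of the edges whose vertices in `S₁`
all belong to `u`. -/
abbrev overSigma (u : Finset S₁) : MeasurableSpace (DirColouring K (S₁ ⊕ S₂)) :=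
  ⨆ t : Finset S₂, localSigma K (Sum.inl '' (u : Set S₁) ∪ Sum.inr '' (t : Set S₂))

theorem overSigma_le (u : Finset S₁) : overSigma K S₂ u ≤ MeasurableSpace.pi :=
  iSup_le fun _ => localSigma_le _

theorem measurable_cluster_comp {Ω : Type*} {mΩ : MeasurableSpace Ω} {Z : Fin (k + 1) → Type*}
    [∀ i, MeasurableSpace (Z i)] {S : Type*} {i : Fin (k + 1)} {u : {u : Finset S // u.card = i}}
    {f : Ω → DirColouring Z S}
    (hf : ∀ φ : Fin i ↪ S, Finset.univ.map φ = u.1 → Measurable fun x => f x i φ) :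
    Measurable (cluster i u ∘ f) :=
  measurable_pi_lambda _ fun φ => hf φ.1 φ.2

theorem measurable_cluster {Z : Fin (k + 1) → Type*} [∀ i, MeasurableSpace (Z i)]
    {S : Type*} (i : Fin (k + 1)) (u : {u : Finset S // u.card = i}) :
    Measurable (cluster (Z := Z) i u) :=
  measurable_cluster_comp (f := id) fun φ _ => measurable_apply i φ

theorem measurable_overSigma_cluster (i : Fin (k + 1)) (u : {u : Finset S₁ // u.card = i}) :
    Measurable[overSigma K S₂ u.1]
      (cluster i u ∘ internalize (K := K) (S₁ := S₁) (S₂ := S₂)) := by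
  refine measurable_cluster_comp fun φ hφ => measurable_internalization_of_apply fun j p => ?_
  refine Measurable.mono (measurable_localSigma_apply (i := ⟨i + j, by omega⟩)
    (e := glue φ p.1 p.2)
    (D := Sum.inl '' (u.1 : Set S₁) ∪ Sum.inr '' (Finset.univ.map p.2 : Finset S₂))
    fun x => ?_) ?_ le_rfl
  · have hx : glue φ p.1 p.2 x ∈ Set.range (glue φ p.1 p.2) := ⟨x, rfl⟩
    rw [mem_range_glue] at hx
    obtain ⟨y | y, hy⟩ := hx
    · rw [← hy, ← hφ]
      simp
    · rw [← hy]
      simp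
  · exact le_iSup (fun t : Finset S₂ =>
      localSigma K (Sum.inl '' (u.1 : Set S₁) ∪ Sum.inr '' (t : Set S₂))) _

/-! ### Relative independence of the clusters. -/

variable [Countable S₁] [Countable S₂] [Infinite S₂] [∀ i, StandardBorelSpace (K i)]

/-- Under an exchangeable law on `S₁ ⊕ S₂`, the parts of the hypergraph over the different
`i`-subsets of `S₁` are conditionally independent given the internalized colours of rank below
`i`. -/
theorem IsExchangeable.iCondIndep_overSigma {μ : Measure (DirColouring K (S₁ ⊕ S₂))}
    [IsFiniteMeasure μ] (hμ : IsExchangeable μ) (i : Fin (k + 1)) :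
    iCondIndep (internalLowerSigma K S₁ S₂ i) (internalLowerSigma_le i)
      (fun u : {u : Finset S₁ // u.card = i} => overSigma K S₂ u.1) μ := by
  classical
  -- Only finitely many vertices of `S₂` may be fixed by `τ`, so independence is proved for the
  -- π-system of events with finite `t`.
  let F : {u : Finset S₁ // u.card = i} → Finset S₂ → MeasurableSpace (DirColouring K (S₁ ⊕ S₂)) :=
    fun u t => localSigma K (Sum.inl '' (u.1 : Set S₁) ∪ Sum.inr '' (t : Set S₂))
  refine iCondIndepSets.iCondIndep _ (fun u => overSigma_le u.1)
    (fun u => ⋃ t : Finset S₂, {B | MeasurableSet[F u t] B}) (fun u => ?_)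
    (fun u => (MeasurableSpace.generateFrom_iUnion_measurableSet (F u)).symm) ?_
  · refine isPiSystem_iUnion_of_monotone _
      (fun t => @MeasurableSpace.isPiSystem_measurableSet _ (F u t)) fun t t' h B hB => ?_
    refine localSigma_mono (Set.union_subset_union_right _ (Set.image_mono ?_)) B hB
    exact Finset.coe_subset.2 h
  · refine iCondIndepSets_of_condExp_ae_eq (internalLowerSigma_le i) _ ?_
      (fun u => avoidSigma K (Sum.inl '' (u.1 : Set S₁))) (fun u => avoidSigma_le _)
      (fun u => internalLowerSigma_le_avoidSigma u.2) ?_ ?_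
    · intro u B hB
      obtain ⟨t, hB⟩ := Set.mem_iUnion.1 hB
      exact localSigma_le _ B hB
    · intro u u' huu' B hB
      obtain ⟨t, hB⟩ := Set.mem_iUnion.1 hB
      -- Distinct sets of the same size do not contain each other.
      refine localSigma_le_avoidSigma (fun h => huu' (Subtype.ext ?_)) B hB
      refine Finset.eq_of_subset_of_card_le (fun s hs => ?_) (by rw [u.2, u'.2])
      simpa using h (Set.mem_image_of_mem _ hs)
    · intro u B hB
      obtain ⟨t, hB⟩ := Set.mem_iUnion.1 hB
      obtain ⟨τ, hτ, hτ'⟩ := exists_embedding_fixing u.1 t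
      exact hμ.condExp_avoidSigma_ae_eq τ hτ (comap_avoidSigma_le_internalLowerSigma u.2 hτ')
        (internalLowerSigma_le_avoidSigma u.2) hB

/-- The internalization of an exchangeable law has relatively independent clusters. -/
theorem IsExchangeable.clustersRelIndep_internalize {μ : Measure (DirColouring K (S₁ ⊕ S₂))}
    [IsFiniteMeasure μ] (hμ : IsExchangeable μ) :
    ClustersRelIndep (μ.map (internalize (S₁ := S₁) (S₂ := S₂))) := fun i =>
  iCondIndepFun_map_of_iCondIndep measurable_internalize (lowerSigma_le _ _ i)
    (internalLowerSigma_le i) rfl (fun u => measurable_cluster i u) (fun u => overSigma_le u.1)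
    (fun u => measurable_overSigma_cluster i u) (hμ.iCondIndep_overSigma i)

end DirColouring

/-! ### The theorem. -/

open DirColouring in
theorem theorem3p23 {k : ℕ} (K : Fin (k + 1) → Type u) [∀ i, Finite (K i)]
    [∀ i, TopologicalSpace (K i)] [∀ i, DiscreteTopology (K i)]
    [∀ i, MeasurableSpace (K i)] [∀ i, BorelSpace (K i)]
    (S₁ : Type v) [Countable S₁] [Infinite S₁] (S₂ : Type w) [Countable S₂] [Infinite S₂]
    (μ : Measure (DirColouring K S₁)) (hμ : DirColouring.IsExchangeable μ) :
    (∃! μ' : Measure (DirColouring K (S₁ ⊕ S₂)), DirColouring.IsExchangeableExtension μ μ') ∧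
    ∀ (μ' : Measure (DirColouring K (S₁ ⊕ S₂))) [IsProbabilityMeasure μ'],
      DirColouring.IsExchangeableExtension μ μ' →
      ∃ (Z : Fin (k + 1) → Type (max u w)) (_ : ∀ i, MetricSpace (Z i))
        (_ : ∀ i, CompactSpace (Z i)) (_ : ∀ i, TotallyDisconnectedSpace (Z i))
        (_ : ∀ i, MeasurableSpace (Z i)) (_ : ∀ i, BorelSpace (Z i))
        (κ : ∀ i, Z i → K i) (Λ : ∀ i, DirColouring.Internalization K S₂ i → Z i),
        (∀ i, Continuous (κ i)) ∧ (∀ i, Continuous (Λ i)) ∧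
        DirColouring.ClustersRelIndep
          ((μ'.map DirColouring.internalize).map (DirColouring.power Λ S₁)) ∧
        μ = ((μ'.map DirColouring.internalize).map (DirColouring.power Λ S₁)).map
          (DirColouring.power κ S₁) := by
  refine ⟨hμ.existsUnique_extension, fun μ' _ hμ' => ?_⟩
  have hmetr : ∀ i, TopologicalSpace.MetrizableSpace (Internalization K S₂ i) := fun i =>
    TopologicalSpace.metrizableSpace_of_t3_secondCountable _
  have hpower : ∀ ν : Measure (DirColouring (Internalization K S₂) S₁),
      ν.map (power (fun _ z => z) S₁) = ν := fun ν => Measure.map_id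
  -- A countable product of finite discrete spaces is compact, metrizable and totally disconnected,
  -- so the internalized palette already qualifies.
  refine ⟨Internalization K S₂, fun i => TopologicalSpace.metrizableSpaceMetric _,
    fun i => (inferInstance : CompactSpace (Internalization K S₂ i)),
    fun i => (inferInstance : TotallyDisconnectedSpace (Internalization K S₂ i)),
    fun i => inferInstance,
    fun i => (inferInstance : BorelSpace (Internalization K S₂ i)),
    externalColour, fun _ z => z, fun i => ?_, fun i => continuous_id, ?_, ?_⟩
  · exact (continuous_apply _).comp (continuous_apply _)
  · simp only [hpower]
    exact hμ'.1.clustersRelIndep_internalize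
  · have hκ : Measurable (power (Y := Internalization K S₂) (externalColour (K := K)) S₁) := by
      refine measurable_of_apply fun i e => ?_
      have h : Measurable (externalColour (K := K) (S₂ := S₂) i) :=
        (measurable_pi_apply _).comp (measurable_pi_apply _)
      exact h.comp (measurable_apply i e)
    rw [hpower, Measure.map_map hκ measurable_internalize, ← hμ'.2]
    congr 1
    funext ω
    exact (power_externalColour_internalize ω).symm
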